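/- Let $X$ be a connected, non-compact $C^\infty$ Riemannian manifold (finite-dimensional, Hausdorff, second countable), and let $\sigma$ be a Borel measure on $X$ that is finite on compact sets, positive on non-empty open sets, non-atomic ($\sigma(\{x\})=0$ for every $x\in X$) and satisfies $\sigma(X)=+\infty$. Let $\Gamma_0=\bigsqcup_{n\ge 0}\Gamma^{(n)}$ be the space of finite configurations, where $\Gamma^{(n)}$ is the set of $n$-point subsets of $X$, topologized as the quotient of $\{(x_1,\dots,x_n)\in X^n: x_i\ne x_j \text{ for } i\neq j\}$ by permutations of the coordinates ($\Gamma^{(0)}=\{\varnothing\}$), and $\Gamma_0$ carries the disjoint union topology and its Borel $\sigma$-algebra. Let $\lambda$ be the Lebesgue–Poisson measure on $\Gamma_0$, $$\lambda(\alpha)=\sum_{n=0}^\infty \frac1{n!}\,\sigma^{\otimes n}\bigl(\{(x_1,\dots,x_n)\in X^n:\ x_i\ne x_j\ (i\neq j),\ \{x_1,\dots,x_n\}\in\alpha\}\bigr),$$ the term $n=0$ being $1$ if $\varnothing\in\alpha$ and $0$ otherwise. Let $\mathcal F_{\mathrm{fin}}(\mathcal D)=\bigoplus_{n\ge0}\mathcal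 F_n(\mathcal D)$, where $\mathcal F_0(\mathcal D)=\mathbb C$ and, for $n\ge 1$, $\mathcal F_n(\mathcal D)$ is the space of complex-valued symmetric $C^\infty$ functions with compact support on $X^n$. An element $f=(f_n)_{n\ge0}$ is regarded as the function $f(\{x_1,\dots,x_n\})=f_n(x_1,\dots,x_n)$ on $\Gamma_0$. For functions $f,g$ on $\Gamma_0$ put $$(f\star g)(\xi)=\sum_{\xi'\sqcup\xi''\sqcup\xi'''=\xi} f(\xi'\cup\xi'')\,g(\xi''\cup\xi'''),$$ the sum being over all ordered decompositions of $\xi$ into three pairwise disjoint, possibly empty parts, and let $\overline f(\xi)=\overline{f(\xi)}$. Finally, put $s(f)=\int_{\Gamma_0} f\,d\lambda$. **Theorem.** (1) The functional $s$ is positive: for every $f\in\mathcal F_{\mathrm{fin}}(\mathcal D)$ the functions $f$ and $f\star\overline f$ are $\lambda$-integrable, $s(f\star\overline f)\ge 0$ (in particular it is real), and $s(f\star\overline f)=0$ implies $f=0$. (2) For every compact $\Lambda\subset X$ there is a constant $C_\Lambda>0$ such that $$\lambda\bigl(\Gamma^{(n)}_\Lambda\bigr)\le C_\Lambda^{\,n}\qquad\text{for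 all } n\in\mathbb N_0,$$ where $\Gamma^{(n)}_\Lambda$ is the set of $n$-point subsets of $\Lambda$. -/

import Mathlib

open scoped Manifold ContDiff ENNReal Nat DirectSum

noncomputable section

namespace PoissonSpectral

/-! ### Finite configurations -/

/-- The space `Γ₀ = Γ₀(X)` of finite configurations: finite sets of (distinct) points of `X`,
including the empty configuration. -/
@[ext]
structure FinConfig (X : Type*) where
  /-- the points of the configuration -/
  points : Finset X

namespace FinConfig

variable {X : Type*}

/-- The number `|ξ|` of points of a configuration. -/
def card (ξ : FinConfig X) : ℕ := ξ.points.card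

/-- The off-diagonal part of `X ^ n`: the `n`-tuples with pairwise different coordinates, as a
measurable and topological subspace of `X ^ n`. -/
abbrev OffDiag (X : Type*) (n : ℕ) : Type _ := {x : Fin n → X // Function.Injective x}

/-- The configuration `[x₁, …, xₙ]`, i.e. the tuple `(x₁, …, xₙ)` with its order forgotten. -/
def ofTuple (n : ℕ) (x : OffDiag X n) : FinConfig X :=
  ⟨Finset.univ.map ⟨x.1, x.2⟩⟩

/-- The ordinary topology of `Γ₀ = ⨆ₙ Γ⁽ⁿ⁾`: the disjoint union of the spaces `Γ⁽ⁿ⁾`, where `Γ⁽ⁿ⁾`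
is the off-diagonal part of `X ^ n` modulo permutations of the coordinates. Explicitly, a set is
open iff for every `n` its preimage among the off-diagonal `n`-tuples is open. -/
instance [TopologicalSpace X] : TopologicalSpace (FinConfig X) :=
  ⨆ n : ℕ, TopologicalSpace.coinduced (ofTuple n) inferInstance

/-- The Borel `σ`-algebra of the ordinary topology. -/
instance [TopologicalSpace X] : MeasurableSpace (FinConfig X) := borel _

instance [TopologicalSpace X] : BorelSpace (FinConfig X) := ⟨rfl⟩

/-- The set `Γ⁽ⁿ⁾_Λ` of the configurations that consist of exactly `n` points, all lying in `Λ`. -/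
def ofCardIn (n : ℕ) (Λ : Set X) : Set (FinConfig X) :=
  {ξ | ξ.card = n ∧ (ξ.points : Set X) ⊆ Λ}

end FinConfig

/-- The Lebesgue–Poisson measure `λ` on `Γ₀` with intensity measure `σ`:
`λ(α) = ∑ₙ (1 / n!) σ⁽ⁿ⁾(α ∩ Γ⁽ⁿ⁾)`, where `σ⁽ⁿ⁾` is the product measure on `X ^ n`, evaluated on
the off-diagonal `n`-tuples whose configuration lies in `α`. For `n = 0` this is the unit mass at
the empty configuration. -/
def lebesguePoisson {X : Type*} [TopologicalSpace X] [MeasurableSpace X]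
    (σ : MeasureTheory.Measure X) : MeasureTheory.Measure (FinConfig X) :=
  MeasureTheory.Measure.sum fun n : ℕ =>
    ((n ! : ℝ≥0∞)⁻¹) •
      MeasureTheory.Measure.map (FinConfig.ofTuple n)
        ((MeasureTheory.Measure.pi fun _ : Fin n => σ).comap
          (Subtype.val : FinConfig.OffDiag X n → (Fin n → X)))

/-- The functional `s(f) = ∫_{Γ₀} f dλ`. -/
def poissonFunctional {X : Type*} [TopologicalSpace X] [MeasurableSpace X]
    (σ : MeasureTheory.Measure X) (f : FinConfig X → ℂ) : ℂ :=
  ∫ ξ, f ξ ∂(lebesguePoisson σ)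

/-! ### The Kondratiev–Kuna convolution -/

open Classical in
/-- The Kondratiev–Kuna convolution: `(f ⋆ g)(ξ)` is the sum of `f(ξ' ∪ ξ'') g(ξ'' ∪ ξ''')` over all
decompositions of `ξ` into three pairwise disjoint, possibly empty parts `ξ', ξ'', ξ'''`. -/
def kkConv {X : Type*} (f g : FinConfig X → ℂ) (ξ : FinConfig X) : ℂ :=
  ∑ p ∈ (ξ.points.powerset ×ˢ ξ.points.powerset ×ˢ ξ.points.powerset).filter
      (fun p => Disjoint p.1 p.2.1 ∧ Disjoint p.1 p.2.2 ∧ Disjoint p.2.1 p.2.2 ∧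
        p.1 ∪ p.2.1 ∪ p.2.2 = ξ.points),
    f ⟨p.1 ∪ p.2.1⟩ * g ⟨p.2.1 ∪ p.2.2⟩

/-- The involution `f ↦ f̄`. -/
def conjFun {X : Type*} (f : FinConfig X → ℂ) (ξ : FinConfig X) : ℂ :=
  (starRingEnd ℂ) (f ξ)

/-! ### The space of finite sequences of test functions -/

/-- `ℱₙ(𝒟)`: the complex-valued symmetric `C^∞` functions with compact support on `X ^ n`, where `X`
is a `d`-dimensional manifold. For `n = 0` the space `X ^ 0` is a point, and this is `ℂ`. -/
def SymTest (d : ℕ) (X : Type*) [TopologicalSpace X] [ChartedSpace (EuclideanSpace ℝ (Fin d)) X]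
    (n : ℕ) : Submodule ℂ ((Fin n → X) → ℂ) where
  carrier := {F | ContMDiff (ModelWithCorners.pi fun _ : Fin n => 𝓡 d) 𝓘(ℝ, ℂ) ∞ F ∧
    HasCompactSupport F ∧ ∀ (τ : Equiv.Perm (Fin n)) (x : Fin n → X), F (x ∘ τ) = F x}
  add_mem' := by
    rintro F G ⟨hF, cF, sF⟩ ⟨hG, cG, sG⟩
    exact ⟨hF.add hG, cF.add cG, fun τ x => by simp [sF τ x, sG τ x]⟩
  zero_mem' := ⟨contMDiff_const, HasCompactSupport.zero, fun _ _ => rfl⟩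
  smul_mem' := by
    rintro c F ⟨hF, cF, sF⟩
    refine ⟨?_, cF.comp_left (g := fun z => c • z) (smul_zero c), fun τ x => by simp [sF τ x]⟩
    have h : ContDiff ℝ ∞ (fun z : ℂ => c • z) := by fun_prop
    exact h.contMDiff.comp hF

/-- `ℱ_fin(𝒟) = ⨁ₙ ℱₙ(𝒟)`: the finite sequences `f = (f₀, f₁, …)` with `fₙ ∈ ℱₙ(𝒟)`. -/
abbrev FinSeq (d : ℕ) (X : Type*) [TopologicalSpace X]
    [ChartedSpace (EuclideanSpace ℝ (Fin d)) X] : Type _ :=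
  ⨁ n : ℕ, SymTest d X n

/-- A finite sequence `f = (f₀, f₁, …)` viewed as the function `f(ξ) = fₙ(x₁, …, xₙ)` of the
configuration `ξ = [x₁, …, xₙ]`; the enumeration of `ξ` is irrelevant as `fₙ` is symmetric. -/
def FinSeq.toFun {d : ℕ} {X : Type*} [TopologicalSpace X]
    [ChartedSpace (EuclideanSpace ℝ (Fin d)) X] (f : FinSeq d X) (ξ : FinConfig X) : ℂ :=
  (f ξ.card : (Fin ξ.card → X) → ℂ) fun i => (ξ.points.equivFin.symm i : X)

end PoissonSpectral

end

noncomputable section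

namespace PoissonSpectral

open MeasureTheory

variable {X : Type*}

/-! ### Functions of finite multisets -/

/-! Positivity comes from writing `s` as a sum of squares. Put D(η) = ∫ f(ξ ∪ η) dλ(ξ). Then s(f ⋆
f̄) = ∫ |D(η)|² dλ(η), which is `poissonFunctional_kkConv`. There are n!/(i! j! k!) decompositions
of n points into parts of sizes i, j, k, so the weight 1/n! of λ becomes 1/(i! j! k!)
(`inv_factorial_mul_sum_decompositions`). With the shared part η fixed, the integral over the two
outer parts factors by Fubini (`fubini_decomposition`).

If s(f ⋆ f̄) = 0, then D vanishes almost everywhere. On the highest level where f may be non-zero, D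
is f itself, because integrating out further points gives zero. There f is continuous and the
measure has full support, so f vanishes, and one descends level by level (`tuple_eq_zero`).

Since σ has no atoms, diagonals are null and integrals run over all of X^n. Accordingly f is
extended to multisets, where repeated points are allowed and symmetry is built in.

The growth bound holds because the tuples that enumerate configurations in Λ lie in Λ^n. -/

theorem exists_perm_of_map_univ_eq {n : ℕ} {x y : Fin n → X}
    (h : (Finset.univ : Finset (Fin n)).val.map x = Finset.univ.val.map y) :
    ∃ τ : Equiv.Perm (Fin n), x = y ∘ τ := by
  classical
  -- The fibre over a has as many elements as the multiplicity of a in the common multiset;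
  -- fibrewise bijections then glue to a permutation.
  have hc : ∀ a, Fintype.card {i // x i = a} = Fintype.card {i // y i = a} := by
    intro a
    have := congrArg (Multiset.count a) h
    rw [Multiset.count_map, Multiset.count_map] at this
    rw [Fintype.card_subtype, Fintype.card_subtype]
    simpa [Finset.card, eq_comm] using this
  let e : ∀ a, {i // x i = a} ≃ {i // y i = a} := fun a => Fintype.equivOfCardEq (hc a)
  refine ⟨(Equiv.sigmaFiberEquiv x).symm.trans
    ((Equiv.sigmaCongrRight e).trans (Equiv.sigmaFiberEquiv y)), ?_⟩
  funext i
  exact (e (x i) ⟨i, rfl⟩).2.symm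

theorem map_get_univ (l : List X) :
    (Finset.univ : Finset (Fin l.length)).val.map l.get = (l : Multiset X) := by
  rw [Fin.univ_val_map, List.ofFn_get]

/-- A finite subset of an index type, enumerated: the corresponding multiset of values. -/
theorem map_val_eq_map_univ {ι : Type*} (S : Finset ι) (x : ι → X) :
    S.val.map x =
      (Finset.univ : Finset (Fin S.card)).val.map fun i => x (S.equivFin.symm i) := by
  have h : (S.attach.val.map Subtype.val) = S.val := Finset.attach_val S ▸ Multiset.attach_map_val _
  have h2 : (Finset.univ : Finset (Fin S.card)).val.map S.equivFin.symm = S.attach.val :=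
    Multiset.map_univ_val_equiv S.equivFin.symm
  conv_lhs => rw [← h, ← h2, Multiset.map_map, Multiset.map_map]
  rfl

/-- A function of finite multisets which is continuous on tuples of any fixed length, vanishes on
large multisets and on the multisets with a point outside some compact set. -/
structure IsTestFunction [TopologicalSpace X] (G : Multiset X → ℂ) : Prop where
  continuous_tuple : ∀ n : ℕ, Continuous fun x : Fin n → X => G (Finset.univ.val.map x)
  exists_compact : ∃ K : Set X, IsCompact K ∧ ∀ s, G s ≠ 0 → ∀ a ∈ s, a ∈ K
  exists_card_bound : ∃ N : ℕ, ∀ s, N ≤ s.card → G s = 0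

namespace IsTestFunction

variable [TopologicalSpace X] {G : Multiset X → ℂ}

theorem continuous_map (hG : IsTestFunction G) {ι : Type*} (S : Finset ι) :
    Continuous fun x : ι → X => G (S.val.map x) := by
  simp_rw [map_val_eq_map_univ S]
  exact (hG.continuous_tuple S.card).comp (continuous_pi fun i => continuous_apply _)

/-- Every index lies in S or in T, so a non-zero product forces every coordinate into the compact
set of G. -/
theorem hasCompactSupport_mul (hG : IsTestFunction G) {ι : Type*} [Fintype ι] [DecidableEq ι]
    [T2Space X] {S T : Finset ι} (h : S ∪ T = Finset.univ) :
    HasCompactSupport fun x : ι → X => G (S.val.map x) * (starRingEnd ℂ) (G (T.val.map x)) := by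
  obtain ⟨K, hK, hGK⟩ := hG.exists_compact
  refine HasCompactSupport.intro (K := Set.univ.pi fun _ => K) (isCompact_univ_pi fun _ => hK) ?_
  intro x hx
  by_contra hne
  refine hx fun i _ => ?_
  have h1 : G (S.val.map x) ≠ 0 := fun h0 => hne (by simp [h0])
  have h2 : G (T.val.map x) ≠ 0 := fun h0 => hne (by simp [h0])
  have hi : i ∈ S ∪ T := h ▸ Finset.mem_univ i
  rcases Finset.mem_union.1 hi with hi | hi
  · exact hGK _ h1 _ (Multiset.mem_map_of_mem x hi)
  · exact hGK _ h2 _ (Multiset.mem_map_of_mem x hi)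

theorem hasCompactSupport_tuple (hG : IsTestFunction G) (n : ℕ) [T2Space X] :
    HasCompactSupport fun x : Fin n → X => G (Finset.univ.val.map x) := by
  obtain ⟨K, hK, hGK⟩ := hG.exists_compact
  refine HasCompactSupport.intro (K := Set.univ.pi fun _ => K) (isCompact_univ_pi fun _ => hK) ?_
  intro x hx
  by_contra hne
  exact hx fun i _ => hGK _ hne _ (Multiset.mem_map_of_mem x (Finset.mem_univ_val i))

end IsTestFunction

/-! ### Finite sequences as test functions of multisets -/

section FinSeq

variable {d : ℕ} [TopologicalSpace X] [ChartedSpace (EuclideanSpace ℝ (Fin d)) X]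

/-- A finite sequence of symmetric functions, viewed as a function of finite multisets. -/
def FinSeq.onMultiset (f : FinSeq d X) (s : Multiset X) : ℂ :=
  (f s.card : (Fin s.card → X) → ℂ) fun i => s.toList.get (i.cast (Multiset.length_toList s).symm)

theorem FinSeq.onMultiset_map_univ (f : FinSeq d X) (n : ℕ) (x : Fin n → X) :
    f.onMultiset (Finset.univ.val.map x) = (f n : (Fin n → X) → ℂ) x := by
  -- With the multiset left general, n can be replaced by its cardinality, which avoids a cast in
  -- the dependent family `f n`.
  have key : ∀ (s : Multiset X) (_ : s.card = n), s = Finset.univ.val.map x →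
      f.onMultiset s = (f n : (Fin n → X) → ℂ) x := by
    rintro s rfl hx
    have h : (Finset.univ : Finset (Fin s.card)).val.map
        (fun i => s.toList.get (i.cast (Multiset.length_toList s).symm)) =
        Finset.univ.val.map x := by
      rw [← hx]
      have h2 : (Finset.univ : Finset (Fin s.card)).val.map
          (finCongr (Multiset.length_toList s).symm) =
          (Finset.univ : Finset (Fin s.toList.length)).val :=
        Multiset.map_univ_val_equiv _
      have h3 : (Finset.univ : Finset (Fin s.toList.length)).val.map s.toList.get = s := by
        rw [map_get_univ, Multiset.coe_toList]
      conv_rhs => rw [← h3, ← h2, Multiset.map_map]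
      rfl
    obtain ⟨τ, hτ⟩ := exists_perm_of_map_univ_eq h
    rw [FinSeq.onMultiset, hτ]
    exact (f s.card).2.2.2 τ x
  exact key _ (by simp) rfl

theorem FinSeq.toFun_eq (f : FinSeq d X) (ξ : FinConfig X) :
    f.toFun ξ = f.onMultiset ξ.points.val := by
  have h := map_val_eq_map_univ ξ.points (id : X → X)
  rw [Multiset.map_id] at h
  rw [h, FinSeq.onMultiset_map_univ]
  rfl

theorem FinSeq.isTestFunction (f : FinSeq d X) : IsTestFunction f.onMultiset := by
  classical
  have hrep : ∀ s : Multiset X, ∃ x : Fin s.card → X, s = Finset.univ.val.map x := by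
    intro s
    induction s using Quotient.inductionOn with
    | _ l => exact ⟨l.get, (map_get_univ l).symm⟩
  refine ⟨fun n => ?_, ?_, ?_⟩
  · simp_rw [FinSeq.onMultiset_map_univ]
    exact (f n).2.1.continuous
  -- All coordinate projections of the supports of the finitely many non-zero components.
  · refine ⟨⋃ n ∈ DFinsupp.support f, ⋃ i : Fin n,
      (fun x : Fin n → X => x i) '' tsupport (f n : (Fin n → X) → ℂ), ?_, ?_⟩
    · exact (DFinsupp.support f).isCompact_biUnion fun n _ => isCompact_iUnion fun i =>
        (f n).2.2.1.isCompact.image (continuous_apply i)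
    · intro s hs a ha
      obtain ⟨x, hx⟩ := hrep s
      rw [hx, FinSeq.onMultiset_map_univ] at hs
      rw [hx] at ha
      obtain ⟨i, -, rfl⟩ := Multiset.mem_map.1 ha
      have hn : s.card ∈ DFinsupp.support f := by
        rw [DFinsupp.mem_support_iff]
        intro h0
        exact hs (by rw [h0]; rfl)
      exact Set.mem_biUnion hn (Set.mem_iUnion.2 ⟨i, x, subset_tsupport _ hs, rfl⟩)
  · refine ⟨(DFinsupp.support f).sup id + 1, fun s hs => ?_⟩
    obtain ⟨x, hx⟩ := hrep s
    by_contra hne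
    rw [hx, FinSeq.onMultiset_map_univ] at hne
    have hn : s.card ∈ DFinsupp.support f := by
      rw [DFinsupp.mem_support_iff]
      intro h0
      exact hne (by rw [h0]; rfl)
    have := Finset.le_sup (f := id) hn
    simp only [id] at this
    omega

end FinSeq

/-! ### The Kondratiev-Kuna convolution on tuples -/

/-- The value of `f ⋆ f̄` at a tuple, the sum being over the sets of indices of the points. -/
def tupleConv (G : Multiset X → ℂ) (n : ℕ) (x : Fin n → X) : ℂ :=
  ∑ A ∈ (Finset.univ : Finset (Fin n)).powerset, ∑ B ∈ (Finset.univ \ A).powerset,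
    G ((A ∪ B).val.map x) * (starRingEnd ℂ) (G ((B ∪ (Finset.univ \ A) \ B).val.map x))

/-- An injective tuple identifies subsets of its configuration with sets of indices. The third part
is the complement of the other two, hence a sum over A and B only. -/
theorem kkConv_ofTuple {F : FinConfig X → ℂ} {G : Multiset X → ℂ}
    (hF : ∀ ξ, F ξ = G ξ.points.val) (n : ℕ) (x : FinConfig.OffDiag X n) :
    kkConv F (conjFun F) (FinConfig.ofTuple n x) = tupleConv G n x.1 := by
  classical
  have hmap : ∀ S : Finset (Fin n), F ⟨S.map ⟨x.1, x.2⟩⟩ = G (S.val.map x.1) := fun S => by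
    rw [hF]; rfl
  rw [kkConv, tupleConv, Finset.sum_sigma']
  symm
  refine Finset.sum_bij (fun (p : Σ _ : Finset (Fin n), Finset (Fin n)) _ =>
    (p.1.map ⟨x.1, x.2⟩, p.2.map ⟨x.1, x.2⟩, ((Finset.univ \ p.1) \ p.2).map ⟨x.1, x.2⟩))
    ?_ ?_ ?_ ?_
  · rintro ⟨A, B⟩ hp
    simp only [Finset.mem_sigma, Finset.mem_powerset] at hp
    rw [Finset.mem_filter]
    simp only [Finset.mem_product, Finset.mem_powerset, FinConfig.ofTuple,
      Finset.map_subset_map, Finset.disjoint_map, ← Finset.map_union, Finset.map_inj]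
    refine ⟨⟨Finset.subset_univ _, Finset.subset_univ _, Finset.subset_univ _⟩, ?_, ?_,
      Finset.disjoint_sdiff, ?_⟩
    · exact Finset.disjoint_left.2 fun a ha hb => (Finset.mem_sdiff.1 (hp.2 hb)).2 ha
    · exact Finset.disjoint_left.2 fun a ha hb => by simp [ha] at hb
    · ext a
      simp only [Finset.mem_union, Finset.mem_sdiff, Finset.mem_univ, true_and, iff_true]
      tauto
  · rintro ⟨A, B⟩ _ ⟨A', B'⟩ _ h
    simp only [Prod.mk.injEq, Finset.map_inj] at h
    rw [h.1, h.2.1]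
  · rintro ⟨A, B, C⟩ hp
    rw [Finset.mem_filter] at hp
    simp only [Finset.mem_product, Finset.mem_powerset, FinConfig.ofTuple] at hp
    obtain ⟨⟨hA, hB, hC⟩, h⟩ := hp
    obtain ⟨A, -, rfl⟩ := Finset.subset_map_iff.1 hA
    obtain ⟨B, -, rfl⟩ := Finset.subset_map_iff.1 hB
    obtain ⟨C, -, rfl⟩ := Finset.subset_map_iff.1 hC
    simp only [Finset.disjoint_map, ← Finset.map_union, Finset.map_inj] at h
    obtain ⟨hAB, hAC, hBC, hU⟩ := h
    have hCeq : (Finset.univ \ A) \ B = C := by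
      ext a
      have hm : a ∈ A ∪ B ∪ C := hU ▸ Finset.mem_univ a
      have h1 : a ∈ A → a ∉ C := fun h => Finset.disjoint_left.1 hAC h
      have h2 : a ∈ B → a ∉ C := fun h => Finset.disjoint_left.1 hBC h
      simp only [Finset.mem_union] at hm
      simp only [Finset.mem_sdiff, Finset.mem_univ, true_and]
      tauto
    refine ⟨⟨A, B⟩, ?_, by rw [hCeq]⟩
    simp only [Finset.mem_sigma, Finset.mem_powerset]
    exact ⟨Finset.subset_univ _, fun a ha => Finset.mem_sdiff.2
      ⟨Finset.mem_univ a, fun hb => Finset.disjoint_left.1 hAB hb ha⟩⟩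
  · rintro ⟨A, B⟩ _
    simp only [conjFun, ← Finset.map_union, hmap]

/-! ### The Lebesgue-Poisson measure -/

theorem continuous_ofTuple (n : ℕ) [TopologicalSpace X] : Continuous (FinConfig.ofTuple (X := X) n) :=
  continuous_iff_coinduced_le.2
    (le_iSup (fun n => TopologicalSpace.coinduced (FinConfig.ofTuple (X := X) n) inferInstance) n)

theorem FinConfig.continuous_of_tuple [TopologicalSpace X] {Y : Type*} [TopologicalSpace Y] {h : FinConfig X → Y}
    (hh : ∀ n, Continuous fun x : FinConfig.OffDiag X n => h (FinConfig.ofTuple n x)) :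
    Continuous h :=
  continuous_iSup_dom.2 fun n => continuous_coinduced_dom.2 (hh n)

theorem FinConfig.measurableSet_ofCardIn [TopologicalSpace X] (n : ℕ) {Λ : Set X} (hΛ : IsClosed Λ) :
    MeasurableSet (FinConfig.ofCardIn n Λ) := by
  have : IsClosed (FinConfig.ofCardIn n Λ) := by
    refine isClosed_iSup_iff.2 fun m => isClosed_coinduced.2 ?_
    by_cases hmn : m = n
    · have : FinConfig.ofTuple m ⁻¹' FinConfig.ofCardIn n Λ =
          ⋂ i, {x : FinConfig.OffDiag X m | x.1 i ∈ Λ} := by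
        ext x
        simp [FinConfig.ofCardIn, FinConfig.ofTuple, FinConfig.card, hmn, Set.range_subset_iff]
      rw [this]
      exact isClosed_iInter fun i =>
        hΛ.preimage ((continuous_apply i).comp continuous_subtype_val)
    · have : FinConfig.ofTuple m ⁻¹' FinConfig.ofCardIn n Λ = ∅ := by
        ext x
        simp [FinConfig.ofCardIn, FinConfig.ofTuple, FinConfig.card, hmn]
      rw [this]
      exact isClosed_empty
  exact this.measurableSet

theorem measurable_ofTuple [TopologicalSpace X] [SecondCountableTopology X] [MeasurableSpace X]
    [BorelSpace X] (n : ℕ) : Measurable (FinConfig.ofTuple (X := X) n) :=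
  (continuous_ofTuple n).measurable

section Measure

variable [TopologicalSpace X] [T2Space X] [SecondCountableTopology X] [MeasurableSpace X]
  [BorelSpace X]

theorem measurableSet_injective (n : ℕ) :
    MeasurableSet {x : Fin n → X | Function.Injective x} := by
  have : {x : Fin n → X | Function.Injective x} =
      ⋂ i, ⋂ j, ⋂ _ : i ≠ j, {x : Fin n → X | x i = x j}ᶜ := by
    ext x
    simp only [Set.mem_ofPred_eq, Set.mem_iInter, Set.mem_compl_iff, Function.Injective]
    exact ⟨fun h i j hij he => hij (h he), fun h i j he => by_contra fun hij => h i j hij he⟩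
  rw [this]
  refine MeasurableSet.iInter fun i => MeasurableSet.iInter fun j => MeasurableSet.iInter fun _ => ?_
  exact (isClosed_eq (continuous_apply i) (continuous_apply j)).measurableSet.compl

theorem integrable_offDiag (σ : Measure X) {n : ℕ} {H : (Fin n → X) → ℂ}
    (hH : Integrable H (Measure.pi fun _ : Fin n => σ)) :
    Integrable (fun x : FinConfig.OffDiag X n => H x.1)
      ((Measure.pi fun _ : Fin n => σ).comap Subtype.val) := by
  have he : MeasurableEmbedding (Subtype.val : FinConfig.OffDiag X n → (Fin n → X)) :=
    MeasurableEmbedding.subtype_coe (measurableSet_injective (X := X) n)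
  refine (he.integrable_map_iff (g := H)).1 ?_
  have hr := map_comap_subtype_coe (measurableSet_injective (X := X) n)
    (Measure.pi fun _ : Fin n => σ)
  exact hr ▸ hH.restrict

/-- Integration with respect to the Lebesgue-Poisson measure, one number of points at a time. -/
theorem integrable_lebesguePoisson (σ : Measure X) {h : FinConfig X → ℂ} {H : ∀ n, (Fin n → X) → ℂ}
    (hc : ∀ n, Continuous (H n)) (hi : ∀ n, Integrable (H n) (Measure.pi fun _ : Fin n => σ))
    (hh : ∀ n x, h (FinConfig.ofTuple n x) = H n x.1) {M : ℕ} (hM : ∀ n, M ≤ n → H n = 0) :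
    Integrable h (lebesguePoisson σ) := by
  have hcont : Continuous h := FinConfig.continuous_of_tuple fun n => by
    simp_rw [hh]
    exact (hc n).comp continuous_subtype_val
  have hmap : ∀ n, Integrable h (Measure.map (FinConfig.ofTuple n)
      ((Measure.pi fun _ : Fin n => σ).comap
        (Subtype.val : FinConfig.OffDiag X n → (Fin n → X)))) := fun n => by
    rw [integrable_map_measure hcont.measurable.aestronglyMeasurable
      (measurable_ofTuple n).aemeasurable]
    have := integrable_offDiag σ (hi n)
    refine this.congr (ae_of_all _ fun x => (hh n x).symm)
  refine integrable_sum_measure (fun n => (hmap n).smul_measure ?_) ?_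
  · simp [Nat.factorial_ne_zero]
  · refine summable_of_ne_finset_zero (s := Finset.range M) fun n hn => ?_
    rw [integral_smul_measure, integral_map (measurable_ofTuple n).aemeasurable
      hcont.measurable.norm.aestronglyMeasurable]
    simp [hh, hM n (by simpa using hn)]

variable (σ : Measure X) [SigmaFinite σ]

/-- After coordinate i is split off, the slices of the diagonal over the remaining coordinates are
singletons, hence null. -/
theorem pi_eq_coord_null [NullSingletonClass σ] {n : ℕ} {i j : Fin n} (hij : i ≠ j) :
    Measure.pi (fun _ : Fin n => σ) {x | x i = x j} = 0 := by
  obtain _ | n := n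
  · exact i.elim0
  obtain ⟨k, rfl⟩ := Fin.exists_succAbove_eq hij.symm
  have hm := measurePreserving_piFinSuccAbove (fun _ : Fin (n + 1) => σ) i
  have hs : MeasurableSet {p : X × (Fin n → X) | p.1 = p.2 k} :=
    measurableSet_eq_fun measurable_fst ((measurable_pi_apply k).comp measurable_snd)
  have h := hm.measure_preimage hs.nullMeasurableSet
  have hz : (σ.prod (Measure.pi fun _ : Fin n => σ)) {p : X × (Fin n → X) | p.1 = p.2 k} = 0 := by
    rw [Measure.prod_apply_symm hs]
    simp
  rw [hz] at h
  exact h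

theorem ae_injective [NullSingletonClass σ] (n : ℕ) :
    ∀ᵐ x ∂Measure.pi (fun _ : Fin n => σ), Function.Injective x := by
  have h : ∀ᵐ x ∂Measure.pi (fun _ : Fin n => σ), ∀ i j, i ≠ j → x i ≠ x j := by
    rw [ae_all_iff]; intro i
    rw [ae_all_iff]; intro j
    by_cases hij : i = j
    · exact ae_of_all _ fun x h => absurd hij h
    · have := pi_eq_coord_null σ hij
      rw [ae_iff]
      refine measure_mono_null ?_ this
      intro x hx
      simp only [Set.mem_ofPred_eq, not_forall, not_not] at hx
      exact hx.2
  filter_upwards [h] with x hx i j he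
  exact by_contra fun hij => hx i j hij he

theorem integral_offDiag [NullSingletonClass σ] {n : ℕ} (H : (Fin n → X) → ℂ) :
    ∫ x : FinConfig.OffDiag X n, H x.1 ∂((Measure.pi fun _ : Fin n => σ).comap Subtype.val) =
      ∫ x, H x ∂(Measure.pi fun _ : Fin n => σ) := by
  have h := integral_subtype_comap (μ := Measure.pi fun _ : Fin n => σ)
    (measurableSet_injective (X := X) n) H
  refine h.trans ?_
  congr 1
  exact Measure.restrict_eq_self_of_ae_mem (ae_injective σ n)

theorem integral_lebesguePoisson [NullSingletonClass σ] {h : FinConfig X → ℂ}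
    {H : ∀ n, (Fin n → X) → ℂ}
    (hc : ∀ n, Continuous (H n)) (hi : ∀ n, Integrable (H n) (Measure.pi fun _ : Fin n => σ))
    (hh : ∀ n x, h (FinConfig.ofTuple n x) = H n x.1) {M : ℕ} (hM : ∀ n, M ≤ n → H n = 0) :
    ∫ ξ, h ξ ∂(lebesguePoisson σ) =
      ∑' n, (n ! : ℂ)⁻¹ * ∫ x, H n x ∂(Measure.pi fun _ : Fin n => σ) := by
  have hcont : Continuous h := FinConfig.continuous_of_tuple fun n => by
    simp_rw [hh]
    exact (hc n).comp continuous_subtype_val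
  rw [lebesguePoisson, integral_sum_measure (integrable_lebesguePoisson σ hc hi hh hM)]
  refine tsum_congr fun n => ?_
  rw [integral_smul_measure, integral_map (measurable_ofTuple n).aemeasurable
      hcont.measurable.aestronglyMeasurable]
  simp_rw [hh]
  rw [integral_offDiag σ (H n)]
  simp

/-- Only the n-th summand of λ contributes, its tuples lie in Λ^n, and the factor 1/n! ≤ 1 is
dropped. -/
theorem lebesguePoisson_ofCardIn_le (n : ℕ) {Λ : Set X} (hΛ : IsClosed Λ) :
    lebesguePoisson σ (FinConfig.ofCardIn n Λ) ≤ σ Λ ^ n := by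
  have hS := FinConfig.measurableSet_ofCardIn n hΛ
  rw [lebesguePoisson, Measure.sum_apply _ hS, tsum_eq_single n]
  · rw [Measure.smul_apply, Measure.map_apply (measurable_ofTuple n) hS, smul_eq_mul]
    have h1 : ((n ! : ℝ≥0∞)⁻¹) ≤ 1 := by
      rw [ENNReal.inv_le_one]
      exact_mod_cast Nat.succ_le_of_lt (Nat.factorial_pos n)
    have h2 := comap_subtype_coe_apply (measurableSet_injective (X := X) n)
      (Measure.pi fun _ : Fin n => σ) (FinConfig.ofTuple n ⁻¹' FinConfig.ofCardIn n Λ)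
    have h3 : Measure.pi (fun _ : Fin n => σ)
        (Subtype.val '' (FinConfig.ofTuple n ⁻¹' FinConfig.ofCardIn n Λ)) ≤ σ Λ ^ n := by
      refine (measure_mono (t := Set.univ.pi fun _ => Λ) ?_).trans ?_
      · rintro _ ⟨x, hx, rfl⟩ i -
        refine hx.2 ?_
        simp [FinConfig.ofTuple]
      · simp [Measure.pi_pi]
    calc _ ≤ 1 * _ := mul_le_mul_left h1 _
      _ ≤ _ := by rw [one_mul]; exact h2.le.trans h3
  · intro m hm
    rw [Measure.smul_apply, Measure.map_apply (measurable_ofTuple m) hS]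
    have : FinConfig.ofTuple m ⁻¹' FinConfig.ofCardIn n Λ = ∅ := by
      ext x
      simp [FinConfig.ofCardIn, FinConfig.ofTuple, FinConfig.card, hm]
    rw [this]
    simp

end Measure

/-! ### Combinatorial summation -/

/-- The antidiagonals partition ℕ × ℕ and Φ lives on a square of side M, which only meets those with
n < 2M. -/
theorem tsum_sum_antidiagonal_eq (Φ : ℕ × ℕ → ℂ) (M : ℕ)
    (h : ∀ p : ℕ × ℕ, M ≤ p.1 ∨ M ≤ p.2 → Φ p = 0) :
    ∑' n, ∑ p ∈ Finset.HasAntidiagonal.antidiagonal n, Φ p =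
      ∑ i ∈ Finset.range M, ∑ j ∈ Finset.range M, Φ (i, j) := by
  have hsub : ∀ n, ∑ p ∈ Finset.HasAntidiagonal.antidiagonal n, Φ p =
      ∑ p ∈ Finset.range M ×ˢ Finset.range M with p.1 + p.2 = n, Φ p := by
    intro n
    symm
    refine Finset.sum_subset (fun p hp => ?_) fun p _ hp' => h p ?_
    · exact Finset.HasAntidiagonal.mem_antidiagonal.2 (Finset.mem_filter.1 hp).2
    · rename_i hp
      rw [Finset.HasAntidiagonal.mem_antidiagonal] at hp
      simp only [Finset.mem_filter, Finset.mem_product, Finset.mem_range, hp, and_true] at hp'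
      omega
  rw [tsum_eq_sum (s := Finset.range (2 * M))]
  · simp_rw [hsub]
    rw [Finset.sum_fiberwise_of_maps_to, Finset.sum_product]
    intro p hp
    simp only [Finset.mem_product, Finset.mem_range] at hp ⊢
    omega
  · intro n hn
    refine Finset.sum_eq_zero fun p hp => h p ?_
    rw [Finset.HasAntidiagonal.mem_antidiagonal] at hp
    rw [Finset.mem_range] at hn
    omega

theorem inv_factorial_mul_choose {n : ℕ} {p : ℕ × ℕ} (hp : p ∈ Finset.HasAntidiagonal.antidiagonal n) :
    (n ! : ℂ)⁻¹ * (n.choose p.1 : ℂ) = (p.1 ! : ℂ)⁻¹ * (p.2 ! : ℂ)⁻¹ := by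
  rw [Finset.HasAntidiagonal.mem_antidiagonal] at hp
  subst hp
  have h := Nat.add_choose_mul_factorial_mul_factorial p.1 p.2
  rw [← Nat.choose_symm_add] at h
  have h' : ((p.1 + p.2).choose p.1 : ℂ) * p.1 ! * p.2 ! = ((p.1 + p.2)! : ℂ) := by exact_mod_cast h
  have h1 : (p.1 ! : ℂ) ≠ 0 := by exact_mod_cast Nat.factorial_ne_zero _
  have h2 : (p.2 ! : ℂ) ≠ 0 := by exact_mod_cast Nat.factorial_ne_zero _
  have h3 : ((p.1 + p.2)! : ℂ) ≠ 0 := by exact_mod_cast Nat.factorial_ne_zero _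
  field_simp
  rw [← h']

theorem inv_factorial_mul_sum_powerset (n : ℕ) (g : ℕ → ℕ → ℂ) :
    (n ! : ℂ)⁻¹ * ∑ j ∈ Finset.range (n + 1), n.choose j • g j (n - j) =
      ∑ p ∈ Finset.HasAntidiagonal.antidiagonal n, (p.1 ! : ℂ)⁻¹ * ((p.2 ! : ℂ)⁻¹ * g p.1 p.2) := by
  rw [← Finset.Nat.sum_antidiagonal_eq_sum_range_succ_mk (fun p => n.choose p.1 • g p.1 p.2),
    Finset.mul_sum]
  refine Finset.sum_congr rfl fun p hp => ?_
  rw [nsmul_eq_mul, ← mul_assoc, inv_factorial_mul_choose hp, mul_assoc]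

/-- Choosing A first and B in its complement applies the binomial count twice: 1/n! becomes 1/(i!
m!) with m = n - i, then 1/m! becomes 1/(j! k!). -/
theorem inv_factorial_mul_sum_decompositions (n : ℕ) (I : ℕ → ℕ → ℕ → ℂ) :
    (n ! : ℂ)⁻¹ * ∑ A ∈ (Finset.univ : Finset (Fin n)).powerset,
      ∑ B ∈ (Finset.univ \ A).powerset, I A.card B.card ((Finset.univ \ A) \ B).card =
      ∑ p ∈ Finset.HasAntidiagonal.antidiagonal n, (p.1 ! : ℂ)⁻¹ *
        ∑ q ∈ Finset.HasAntidiagonal.antidiagonal p.2, (q.1 ! : ℂ)⁻¹ * ((q.2 ! : ℂ)⁻¹ * I p.1 q.1 q.2) := by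
  have hinner : ∀ A : Finset (Fin n),
      ∑ B ∈ (Finset.univ \ A).powerset, I A.card B.card ((Finset.univ \ A) \ B).card =
      ∑ j ∈ Finset.range ((n - A.card) + 1),
        (n - A.card).choose j • I A.card j ((n - A.card) - j) := by
    intro A
    have hc : (Finset.univ \ A).card = n - A.card := by
      rw [Finset.card_sdiff_of_subset (Finset.subset_univ A), Finset.card_univ, Fintype.card_fin]
    rw [← hc, ← Finset.sum_powerset_apply_card (fun j => I A.card j ((Finset.univ \ A).card - j))]
    refine Finset.sum_congr rfl fun B hB => ?_
    rw [Finset.card_sdiff_of_subset (Finset.mem_powerset.1 hB)]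
  simp_rw [hinner]
  rw [Finset.sum_powerset_apply_card (fun a => ∑ j ∈ Finset.range ((n - a) + 1),
        (n - a).choose j • I a j ((n - a) - j)), Finset.card_univ, Fintype.card_fin,
    inv_factorial_mul_sum_powerset n (fun a m => ∑ j ∈ Finset.range (m + 1),
        m.choose j • I a j (m - j))]
  refine Finset.sum_congr rfl fun p _ => ?_
  rw [inv_factorial_mul_sum_powerset]

theorem tsum_sum_antidiagonal_antidiagonal (I : ℕ → ℕ → ℕ → ℂ) {N : ℕ}
    (hI : ∀ i j k, N ≤ i ∨ N ≤ j ∨ N ≤ k → I i j k = 0) :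
    ∑' n, ∑ p ∈ Finset.HasAntidiagonal.antidiagonal n, (p.1 ! : ℂ)⁻¹ *
        ∑ q ∈ Finset.HasAntidiagonal.antidiagonal p.2, (q.1 ! : ℂ)⁻¹ * ((q.2 ! : ℂ)⁻¹ * I p.1 q.1 q.2) =
      ∑ i ∈ Finset.range (2 * N), (i ! : ℂ)⁻¹ * ∑ j ∈ Finset.range (2 * N),
        ∑ k ∈ Finset.range (2 * N), (j ! : ℂ)⁻¹ * ((k ! : ℂ)⁻¹ * I i j k) := by
  -- Two sizes with sum at least 2N cannot both be below N. This is why the cutoff is 2N rather than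
  -- N.
  have hz : ∀ i m, 2 * N ≤ m →
      ∑ q ∈ Finset.HasAntidiagonal.antidiagonal m, (q.1 ! : ℂ)⁻¹ * ((q.2 ! : ℂ)⁻¹ * I i q.1 q.2) = 0 := by
    intro i m hm
    refine Finset.sum_eq_zero fun q hq => ?_
    rw [Finset.HasAntidiagonal.mem_antidiagonal] at hq
    rw [hI _ _ _ (by omega)]
    simp
  rw [tsum_sum_antidiagonal_eq (fun p => (p.1 ! : ℂ)⁻¹ *
        ∑ q ∈ Finset.HasAntidiagonal.antidiagonal p.2, (q.1 ! : ℂ)⁻¹ * ((q.2 ! : ℂ)⁻¹ * I p.1 q.1 q.2)) (2 * N)]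
  · refine Finset.sum_congr rfl fun i _ => ?_
    dsimp only
    rw [← Finset.mul_sum]
    congr 1
    rw [← tsum_sum_antidiagonal_eq (fun q => (q.1 ! : ℂ)⁻¹ * ((q.2 ! : ℂ)⁻¹ * I i q.1 q.2)),
      tsum_eq_sum (s := Finset.range (2 * N))]
    · intro m hm
      exact hz i m (by simpa using hm)
    · intro q hq
      simp only [hI i q.1 q.2 (by omega), mul_zero]
  · intro p hp
    rcases hp with hp | hp
    · rw [Finset.sum_eq_zero fun q _ => by rw [hI _ _ _ (by omega)]; simp, mul_zero]
    · simp only [hz p.1 p.2 hp, mul_zero]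

/-! ### Integrating out points -/

/-- The integral of `G` over `i` points, the other `j` points being kept fixed. -/
def integrateOut [MeasurableSpace X] (σ : Measure X) (G : Multiset X → ℂ) (i j : ℕ) (y : Fin j → X) : ℂ :=
  ∫ x, G (Finset.univ.val.map x + Finset.univ.val.map y) ∂(Measure.pi fun _ : Fin i => σ)

/-- Product measures do not depend on how coordinates are indexed. The block of size j, to be shared
by both factors, comes first so as to be the outer Fubini variable. -/
theorem exists_measurePreserving_prod [MeasurableSpace X] (σ : Measure X) [SigmaFinite σ]
    {i j k n : ℕ} (e : Fin j ⊕ (Fin i ⊕ Fin k) ≃ Fin n) :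
    ∃ Φ : (Fin j → X) × ((Fin i → X) × (Fin k → X)) ≃ᵐ (Fin n → X),
      MeasurePreserving Φ ((Measure.pi fun _ => σ).prod ((Measure.pi fun _ => σ).prod
        (Measure.pi fun _ => σ))) (Measure.pi fun _ => σ) ∧
      ∀ p s, Φ p (e s) = Sum.elim p.1 (Sum.elim p.2.1 p.2.2) s := by
  let Φ₁ := MeasurableEquiv.prodCongr (MeasurableEquiv.refl (Fin j → X))
    (MeasurableEquiv.sumPiEquivProdPi (fun _ : Fin i ⊕ Fin k => X)).symm
  let Φ₂ := (MeasurableEquiv.sumPiEquivProdPi (fun _ : Fin j ⊕ (Fin i ⊕ Fin k) => X)).symm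
  let Φ₃ := MeasurableEquiv.piCongrLeft (fun _ : Fin n => X) e
  refine ⟨Φ₁.trans (Φ₂.trans Φ₃), ?_, ?_⟩
  · have h₁ : MeasurePreserving Φ₁ ((Measure.pi fun _ => σ).prod ((Measure.pi fun _ => σ).prod
        (Measure.pi fun _ => σ))) ((Measure.pi fun _ => σ).prod (Measure.pi fun _ => σ)) :=
      (MeasurePreserving.id _).prod
        (measurePreserving_sumPiEquivProdPi_symm (fun _ : Fin i ⊕ Fin k => σ))
    have h₂ := measurePreserving_sumPiEquivProdPi_symm (fun _ : Fin j ⊕ (Fin i ⊕ Fin k) => σ)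
    have h₃ := measurePreserving_piCongrLeft (α := fun _ => X) (fun _ : Fin n => σ) e
    exact h₃.comp (h₂.comp h₁)
  · intro p s
    refine (MeasurableEquiv.piCongrLeft_apply_apply (β := fun _ => X) e _ s).trans ?_
    rcases s with s | s | s <;> rfl

theorem exists_equiv_of_decomposition {n : ℕ} {A B C : Finset (Fin n)} (hAB : Disjoint A B)
    (hAC : Disjoint A C) (hBC : Disjoint B C) (h : ∀ a, a ∈ A ∨ a ∈ B ∨ a ∈ C) :
    ∃ e : Fin B.card ⊕ (Fin A.card ⊕ Fin C.card) ≃ Fin n,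
      A.val = Finset.univ.val.map (fun s => e (.inr (.inl s))) ∧
      B.val = Finset.univ.val.map (fun s => e (.inl s)) ∧
      C.val = Finset.univ.val.map (fun s => e (.inr (.inr s))) := by
  have hval : ∀ S : Finset (Fin n),
      S.val = Finset.univ.val.map (fun s => (S.equivFin.symm s : Fin n)) := fun S => by
    simpa using map_val_eq_map_univ S (id : Fin n → Fin n)
  have hinj : ∀ S : Finset (Fin n), Function.Injective fun s => (S.equivFin.symm s : Fin n) :=
    fun S => Subtype.val_injective.comp S.equivFin.symm.injective
  refine ⟨Equiv.ofBijective (Sum.elim (fun s => (B.equivFin.symm s : Fin n))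
    (Sum.elim (fun s => (A.equivFin.symm s : Fin n)) (fun s => (C.equivFin.symm s : Fin n))))
    ⟨?_, ?_⟩, hval A, hval B, hval C⟩
  · refine (hinj B).sumElim ((hinj A).sumElim (hinj C) fun a c he => ?_) fun b s he => ?_
    · exact Finset.disjoint_left.1 hAC (A.equivFin.symm a).2 (he ▸ (C.equivFin.symm c).2)
    · rcases s with a | c
      · have he' : (B.equivFin.symm b : Fin n) = A.equivFin.symm a := he
        exact Finset.disjoint_left.1 hAB (A.equivFin.symm a).2 (he' ▸ (B.equivFin.symm b).2)
      · have he' : (B.equivFin.symm b : Fin n) = C.equivFin.symm c := he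
        exact Finset.disjoint_left.1 hBC (B.equivFin.symm b).2 (he' ▸ (C.equivFin.symm c).2)
  · intro a
    rcases h a with ha | ha | ha
    · exact ⟨.inr (.inl (A.equivFin ⟨a, ha⟩)), by simp⟩
    · exact ⟨.inl (B.equivFin ⟨a, ha⟩), by simp⟩
    · exact ⟨.inr (.inr (C.equivFin ⟨a, ha⟩)), by simp⟩

/-- Realizes arbitrary sizes by blocks of indices, so that facts proved for decompositions of `Fin
n` hold for all i, j, k. -/
theorem exists_decomposition (i j k : ℕ) : ∃ (n : ℕ) (A B C : Finset (Fin n)),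
    Disjoint A B ∧ Disjoint A C ∧ Disjoint B C ∧ (∀ a, a ∈ A ∨ a ∈ B ∨ a ∈ C) ∧
    A.card = i ∧ B.card = j ∧ C.card = k := by
  let e : Fin i ⊕ (Fin j ⊕ Fin k) ≃ Fin (i + (j + k)) :=
    (Equiv.sumCongr (Equiv.refl _) finSumFinEquiv).trans finSumFinEquiv
  refine ⟨i + (j + k), Finset.univ.map ⟨fun s => e (.inl s), ?_⟩,
    Finset.univ.map ⟨fun s => e (.inr (.inl s)), ?_⟩,
    Finset.univ.map ⟨fun s => e (.inr (.inr s)), ?_⟩, ?_, ?_, ?_, ?_, by simp, by simp, by simp⟩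
  · exact e.injective.comp Sum.inl_injective
  · exact e.injective.comp (Sum.inr_injective.comp Sum.inl_injective)
  · exact e.injective.comp (Sum.inr_injective.comp Sum.inr_injective)
  · simp [Finset.disjoint_left]
  · simp [Finset.disjoint_left]
  · simp [Finset.disjoint_left]
  · intro a
    obtain ⟨s, rfl⟩ := e.surjective a
    rcases s with s | s | s <;> simp

theorem integrateOut_eq_zero [MeasurableSpace X] (σ : Measure X) {G : Multiset X → ℂ} {N i j : ℕ}
    (hN : ∀ s, N ≤ Multiset.card s → G s = 0)
    (h : N ≤ i + j) : integrateOut σ G i j = 0 := by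
  funext y
  have h0 : ∀ x : Fin i → X, G (Finset.univ.val.map x + Finset.univ.val.map y) = 0 := fun x =>
    hN _ (by simpa using h)
  simp only [integrateOut, h0, integral_zero, Pi.zero_apply]

/-! ### Fubini for a decomposition into three parts -/

section Fubini

variable [TopologicalSpace X] [T2Space X] [SecondCountableTopology X] [MeasurableSpace X]
  [BorelSpace X] (σ : Measure X) [SigmaFinite σ] [IsLocallyFiniteMeasure σ] {G : Multiset X → ℂ}

theorem IsTestFunction.integrable_mul (hG : IsTestFunction G) {n : ℕ} {S T : Finset (Fin n)}
    (h : S ∪ T = Finset.univ) :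
    Integrable (fun x => G (S.val.map x) * (starRingEnd ℂ) (G (T.val.map x)))
      (Measure.pi fun _ : Fin n => σ) :=
  Continuous.integrable_of_hasCompactSupport
    ((hG.continuous_map S).mul (Complex.continuous_conj.comp (hG.continuous_map T)))
    (hG.hasCompactSupport_mul h)

/-- With the points of B fixed, one factor depends only on the points of A and the other only on
those of C, so the inner integral is a product. Fubini also yields integrability, with no need for
continuity of `integrateOut`. -/
theorem fubini_decomposition (hG : IsTestFunction G) {n : ℕ} {A B C : Finset (Fin n)}
    (hAB : Disjoint A B) (hAC : Disjoint A C) (hBC : Disjoint B C)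
    (h : ∀ a, a ∈ A ∨ a ∈ B ∨ a ∈ C) :
    Integrable (fun y => integrateOut σ G A.card B.card y *
      (starRingEnd ℂ) (integrateOut σ G C.card B.card y)) (Measure.pi fun _ => σ) ∧
    ∫ x, G ((A ∪ B).val.map x) * (starRingEnd ℂ) (G ((B ∪ C).val.map x))
        ∂(Measure.pi fun _ : Fin n => σ) =
      ∫ y, integrateOut σ G A.card B.card y *
        (starRingEnd ℂ) (integrateOut σ G C.card B.card y) ∂(Measure.pi fun _ => σ) := by
  obtain ⟨e, hA, hB, hC⟩ := exists_equiv_of_decomposition hAB hAC hBC h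
  obtain ⟨Φ, hφ, hφe⟩ := exists_measurePreserving_prod σ e
  have hU : (A ∪ B) ∪ (B ∪ C) = Finset.univ := by
    ext a
    have := h a
    simp only [Finset.mem_union, Finset.mem_univ, iff_true]
    tauto
  have hint := hG.integrable_mul σ hU
  have hval : ∀ {S T : Finset (Fin n)}, Disjoint S T → (S ∪ T).val = S.val + T.val := by
    intro S T hST
    rw [Finset.union_val]
    exact ((Multiset.add_eq_union_iff_disjoint).2 (Finset.disjoint_val.2 hST)).symm
  have hrw : ∀ p, G ((A ∪ B).val.map (Φ p)) * (starRingEnd ℂ) (G ((B ∪ C).val.map (Φ p))) =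
      G (Finset.univ.val.map p.2.1 + Finset.univ.val.map p.1) *
        (starRingEnd ℂ) (G (Finset.univ.val.map p.2.2 + Finset.univ.val.map p.1)) := by
    intro p
    rw [hval hAB, hval hBC, add_comm B.val, Multiset.map_add, Multiset.map_add, hA, hB, hC,
      Multiset.map_map, Multiset.map_map, Multiset.map_map]
    simp only [Function.comp_def, hφe, Sum.elim_inl, Sum.elim_inr]
  have hint' : Integrable (fun p : (Fin B.card → X) × ((Fin A.card → X) × (Fin C.card → X)) =>
      G (Finset.univ.val.map p.2.1 + Finset.univ.val.map p.1) *
        (starRingEnd ℂ) (G (Finset.univ.val.map p.2.2 + Finset.univ.val.map p.1)))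
      ((Measure.pi fun _ => σ).prod ((Measure.pi fun _ => σ).prod (Measure.pi fun _ => σ))) := by
    simp_rw [← hrw]
    exact (hφ.integrable_comp_emb Φ.measurableEmbedding).2 hint
  have hfib : ∀ y : Fin B.card → X,
      ∫ q : (Fin A.card → X) × (Fin C.card → X),
        G (Finset.univ.val.map q.1 + Finset.univ.val.map y) *
        (starRingEnd ℂ) (G (Finset.univ.val.map q.2 + Finset.univ.val.map y))
        ∂((Measure.pi fun _ => σ).prod (Measure.pi fun _ => σ)) =
      integrateOut σ G A.card B.card y *
        (starRingEnd ℂ) (integrateOut σ G C.card B.card y) := by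
    intro y
    rw [integral_prod_mul (fun x : Fin A.card → X =>
      G (Finset.univ.val.map x + Finset.univ.val.map y)) (fun z : Fin C.card → X =>
      (starRingEnd ℂ) (G (Finset.univ.val.map z + Finset.univ.val.map y))), integral_conj]
    rfl
  constructor
  · refine hint'.integral_prod_left.congr (ae_of_all _ fun y => ?_)
    exact hfib y
  · rw [← hφ.integral_comp', funext hrw, integral_prod _ hint']
    exact integral_congr_ae (ae_of_all _ hfib)

theorem IsTestFunction.integrable_integrateOut_mul (hG : IsTestFunction G) (i j k : ℕ) :
    Integrable (fun y => integrateOut σ G i j y * (starRingEnd ℂ) (integrateOut σ G k j y))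
      (Measure.pi fun _ => σ) := by
  obtain ⟨n, A, B, C, hAB, hAC, hBC, h, rfl, rfl, rfl⟩ := exists_decomposition i j k
  exact (fubini_decomposition σ hG hAB hAC hBC h).1

end Fubini

/-! ### The functional as a sum of squares -/

theorem union_union_sdiff_eq_univ {n : ℕ} (A B : Finset (Fin n)) :
    (A ∪ B) ∪ (B ∪ (Finset.univ \ A) \ B) = Finset.univ := by
  ext a
  simp only [Finset.mem_union, Finset.mem_sdiff, Finset.mem_univ, true_and, iff_true]
  tauto

/-- A ∪ B and the union of B with the third part cover n ≥ 2N indices, so one of them has at least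
N. -/
theorem tupleConv_eq_zero {G : Multiset X → ℂ} {N n : ℕ} (hN : ∀ s, N ≤ Multiset.card s → G s = 0)
    (h : 2 * N ≤ n) : tupleConv G n = 0 := by
  funext x
  refine Finset.sum_eq_zero fun A _ => Finset.sum_eq_zero fun B _ => ?_
  have h1 := Finset.card_union_le (A ∪ B) (B ∪ (Finset.univ \ A) \ B)
  rw [union_union_sdiff_eq_univ, Finset.card_univ, Fintype.card_fin] at h1
  by_cases h2 : N ≤ (A ∪ B).card
  · rw [hN ((A ∪ B).val.map x) ((Multiset.card_map _ _).symm ▸ h2), zero_mul]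
  · have h3 : N ≤ (B ∪ (Finset.univ \ A) \ B).card := by omega
    rw [hN ((B ∪ (Finset.univ \ A) \ B).val.map x) ((Multiset.card_map _ _).symm ▸ h3), map_zero,
      mul_zero]

/-- The integral of `G` over all the points but `j`, with less than `M` points integrated out. -/
def partialIntegral [MeasurableSpace X] (σ : Measure X) (G : Multiset X → ℂ) (M j : ℕ) (y : Fin j → X) : ℂ :=
  ∑ i ∈ Finset.range M, (i ! : ℂ)⁻¹ * integrateOut σ G i j y

theorem partialIntegral_mul_conj [MeasurableSpace X] (σ : Measure X) (G : Multiset X → ℂ) (M j : ℕ) (y : Fin j → X) :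
    ((‖partialIntegral σ G M j y‖ ^ 2 : ℝ) : ℂ) =
      ∑ i ∈ Finset.range M, ∑ k ∈ Finset.range M, (i ! : ℂ)⁻¹ * ((k ! : ℂ)⁻¹ *
        (integrateOut σ G i j y * (starRingEnd ℂ) (integrateOut σ G k j y))) := by
  rw [← Complex.normSq_eq_norm_sq, ← Complex.mul_conj, partialIntegral, map_sum,
    Finset.sum_mul_sum]
  refine Finset.sum_congr rfl fun i _ => Finset.sum_congr rfl fun k _ => ?_
  rw [map_mul, map_inv₀, Complex.conj_natCast]
  ring

section Squares

variable [TopologicalSpace X] {G : Multiset X → ℂ}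

theorem IsTestFunction.continuous_tupleConv (hG : IsTestFunction G) (n : ℕ) :
    Continuous (tupleConv G n) :=
  continuous_finsetSum _ fun _ _ => continuous_finsetSum _ fun _ _ =>
    (hG.continuous_map _).mul (Complex.continuous_conj.comp (hG.continuous_map _))

variable [T2Space X] [SecondCountableTopology X] [MeasurableSpace X]
  [BorelSpace X] (σ : Measure X) [SigmaFinite σ] [IsLocallyFiniteMeasure σ]

theorem IsTestFunction.integrable_tuple (hG : IsTestFunction G) (n : ℕ) :
    Integrable (fun x : Fin n → X => G (Finset.univ.val.map x)) (Measure.pi fun _ => σ) :=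
  (hG.continuous_tuple n).integrable_of_hasCompactSupport (hG.hasCompactSupport_tuple n)

theorem IsTestFunction.integrable_tupleConv (hG : IsTestFunction G) (n : ℕ) :
    Integrable (tupleConv G n) (Measure.pi fun _ : Fin n => σ) := by
  exact integrable_finsetSum _ fun A _ => integrable_finsetSum _ fun B _ =>
    hG.integrable_mul σ (union_union_sdiff_eq_univ A B)

theorem IsTestFunction.integral_tupleConv (hG : IsTestFunction G) (n : ℕ) :
    ∫ x, tupleConv G n x ∂(Measure.pi fun _ : Fin n => σ) =
      ∑ A ∈ (Finset.univ : Finset (Fin n)).powerset, ∑ B ∈ (Finset.univ \ A).powerset,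
        ∫ y, integrateOut σ G A.card B.card y * (starRingEnd ℂ)
          (integrateOut σ G ((Finset.univ \ A) \ B).card B.card y) ∂(Measure.pi fun _ => σ) := by
  have hint : ∀ A B : Finset (Fin n),
      Integrable (fun x => G ((A ∪ B).val.map x) *
        (starRingEnd ℂ) (G ((B ∪ (Finset.univ \ A) \ B).val.map x)))
        (Measure.pi fun _ : Fin n => σ) := fun A B =>
    hG.integrable_mul σ (union_union_sdiff_eq_univ A B)
  unfold tupleConv
  rw [integral_finsetSum _ fun A _ => integrable_finsetSum _ fun B _ => hint A B]
  refine Finset.sum_congr rfl fun A _ => ?_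
  rw [integral_finsetSum _ fun B _ => hint A B]
  refine Finset.sum_congr rfl fun B hB => ?_
  rw [Finset.mem_powerset] at hB
  refine (fubini_decomposition σ hG ?_ ?_ Finset.disjoint_sdiff ?_).2
  · exact Finset.disjoint_left.2 fun a ha hb => (Finset.mem_sdiff.1 (hB hb)).2 ha
  · exact Finset.disjoint_left.2 fun a ha hb => by simp [ha] at hb
  · intro a
    simp only [Finset.mem_sdiff, Finset.mem_univ, true_and]
    tauto

theorem IsTestFunction.integrable_sq_partialIntegral (hG : IsTestFunction G) (M j : ℕ) :
    Integrable (fun y => ‖partialIntegral σ G M j y‖ ^ 2) (Measure.pi fun _ : Fin j => σ) := by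
  have h : Integrable (fun y => ((‖partialIntegral σ G M j y‖ ^ 2 : ℝ) : ℂ))
      (Measure.pi fun _ : Fin j => σ) := by
    simp_rw [partialIntegral_mul_conj]
    exact integrable_finsetSum _ fun i _ => integrable_finsetSum _ fun k _ =>
      ((hG.integrable_integrateOut_mul σ i j k).const_mul _).const_mul _
  exact h.re

theorem IsTestFunction.integral_sq_partialIntegral (hG : IsTestFunction G) (M j : ℕ) :
    ((∫ y, ‖partialIntegral σ G M j y‖ ^ 2 ∂(Measure.pi fun _ : Fin j => σ) : ℝ) : ℂ) =
      ∑ i ∈ Finset.range M, ∑ k ∈ Finset.range M, (i ! : ℂ)⁻¹ * ((k ! : ℂ)⁻¹ *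
        ∫ y, integrateOut σ G i j y * (starRingEnd ℂ) (integrateOut σ G k j y)
          ∂(Measure.pi fun _ : Fin j => σ)) := by
  have hint := fun i k => ((hG.integrable_integrateOut_mul σ i j k).const_mul
    ((k ! : ℂ)⁻¹)).const_mul ((i ! : ℂ)⁻¹)
  rw [← integral_complex_ofReal]
  simp_rw [partialIntegral_mul_conj]
  rw [integral_finsetSum _ fun i _ => integrable_finsetSum _ fun k _ => hint i k]
  refine Finset.sum_congr rfl fun i _ => ?_
  rw [integral_finsetSum _ fun k _ => hint i k]
  simp_rw [integral_const_mul]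

theorem IsTestFunction.integrable_kkConv (hG : IsTestFunction G) {F : FinConfig X → ℂ}
    (hF : ∀ ξ, F ξ = G ξ.points.val) :
    Integrable (kkConv F (conjFun F)) (lebesguePoisson σ) := by
  obtain ⟨N, hN⟩ := hG.exists_card_bound
  exact integrable_lebesguePoisson σ hG.continuous_tupleConv
    (hG.integrable_tupleConv σ) (kkConv_ofTuple hF) (fun n hn => tupleConv_eq_zero hN hn)

theorem IsTestFunction.integrable (hG : IsTestFunction G) {F : FinConfig X → ℂ}
    (hF : ∀ ξ, F ξ = G ξ.points.val) : Integrable F (lebesguePoisson σ) := by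
  obtain ⟨N, hN⟩ := hG.exists_card_bound
  refine integrable_lebesguePoisson σ hG.continuous_tuple (hG.integrable_tuple σ)
    (fun n x => hF _) (M := N) (fun n hn => ?_)
  funext x
  exact hN _ (by simpa using hn)

variable [NullSingletonClass σ]

/-- Of the weight 1/(i! j! k!), the factor 1/j! belongs to the outer measure, while 1/i! and 1/k! go
into the two factors of the square. -/
theorem IsTestFunction.poissonFunctional_kkConv (hG : IsTestFunction G) {N : ℕ}
    (hN : ∀ s, N ≤ Multiset.card s → G s = 0) {F : FinConfig X → ℂ}
    (hF : ∀ ξ, F ξ = G ξ.points.val) :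
    poissonFunctional σ (kkConv F (conjFun F)) =
      ((∑ j ∈ Finset.range (2 * N), (j ! : ℝ)⁻¹ *
        ∫ y, ‖partialIntegral σ G (2 * N) j y‖ ^ 2 ∂(Measure.pi fun _ : Fin j => σ) : ℝ) : ℂ) := by
  rw [poissonFunctional, integral_lebesguePoisson σ hG.continuous_tupleConv
    (hG.integrable_tupleConv σ) (kkConv_ofTuple hF) (fun n hn => tupleConv_eq_zero hN hn)]
  simp_rw [hG.integral_tupleConv σ]
  rw [tsum_congr fun n => inv_factorial_mul_sum_decompositions n fun i j k =>
    ∫ y, integrateOut σ G i j y * (starRingEnd ℂ) (integrateOut σ G k j y)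
      ∂(Measure.pi fun _ : Fin j => σ),
    tsum_sum_antidiagonal_antidiagonal (N := N) fun i j k =>
    ∫ y, integrateOut σ G i j y * (starRingEnd ℂ) (integrateOut σ G k j y)
      ∂(Measure.pi fun _ : Fin j => σ)]
  · push_cast
    simp_rw [hG.integral_sq_partialIntegral σ, Finset.mul_sum]
    rw [Finset.sum_comm]
    refine Finset.sum_congr rfl fun j _ => Finset.sum_congr rfl fun i _ =>
      Finset.sum_congr rfl fun k _ => ?_
    ring
  · intro i j k h
    have : integrateOut σ G i j = 0 ∨ integrateOut σ G k j = 0 := by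
      rcases h with h | h | h
      · exact .inl (integrateOut_eq_zero σ hN (by omega))
      · exact .inl (integrateOut_eq_zero σ hN (by omega))
      · exact .inr (integrateOut_eq_zero σ hN (by omega))
    rcases this with h | h <;> simp [h]

/-- If the functional vanishes at `f ⋆ f̄`, then `f` vanishes: the top component of `f` is the top
partial integral, so that the components vanish one after the other. -/
theorem IsTestFunction.tuple_eq_zero [σ.IsOpenPosMeasure] (hG : IsTestFunction G)
    {F : FinConfig X → ℂ} (hF : ∀ ξ, F ξ = G ξ.points.val)
    (h0 : poissonFunctional σ (kkConv F (conjFun F)) = 0) (n : ℕ) (x : Fin n → X) :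
    G (Finset.univ.val.map x) = 0 := by
  obtain ⟨N, hN⟩ := hG.exists_card_bound
  rw [hG.poissonFunctional_kkConv σ hN hF, Complex.ofReal_eq_zero,
    Finset.sum_eq_zero_iff_of_nonneg fun j _ => by positivity] at h0
  have hp : ∀ j, j < 2 * N →
      partialIntegral σ G (2 * N) j =ᵐ[Measure.pi fun _ : Fin j => σ] 0 := by
    intro j hj
    have h := h0 j (Finset.mem_range.2 hj)
    have hf : ((j ! : ℝ)⁻¹) ≠ 0 := by simp [Nat.factorial_ne_zero]
    have h' := (mul_eq_zero.1 h).resolve_left hf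
    rw [integral_eq_zero_iff_of_nonneg (fun y => by positivity)
      (hG.integrable_sq_partialIntegral σ _ j)] at h'
    filter_upwards [h'] with y hy
    simpa using hy
  -- Downward induction on the length n: m bounds how far n lies below N.
  have key : ∀ m n, N ≤ n + m → ∀ x : Fin n → X, G (Finset.univ.val.map x) = 0 := by
    intro m
    induction m with
    | zero => exact fun n hn x => hN _ (by simpa using hn)
    | succ m ih =>
      intro j hj
      by_cases hjN : N ≤ j
      · exact fun x => hN _ (by simpa using hjN)
      have hbig : ∀ s : Multiset X, j < s.card → G s = 0 := by
        intro s hs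
        induction s using Quotient.inductionOn with
        | _ l =>
          have := ih l.length (by
            have : j < l.length := hs
            omega) l.get
          rwa [map_get_univ] at this
      have hout : ∀ i, i ≠ 0 → integrateOut σ G i j = 0 := fun i hi =>
        integrateOut_eq_zero (N := j + 1) σ (fun s hs => hbig s hs) (by omega)
      have hpj : partialIntegral σ G (2 * N) j = fun y => G (Finset.univ.val.map y) := by
        funext y
        rw [partialIntegral, Finset.sum_eq_single_of_mem 0 (Finset.mem_range.2 (by omega))
          fun i _ hi => by simp [hout i hi]]
        -- Only i = 0 is left: 0! = 1, and the measure on the one-point space X^0 has mass 1.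
        simp [integrateOut, Measure.real]
      have hz := hp j (by omega)
      rw [hpj] at hz
      -- A continuous function that vanishes almost everywhere for a measure positive on open sets
      -- vanishes everywhere, diagonals included.
      exact fun x => congrFun ((Continuous.ae_eq_iff_eq _ (hG.continuous_tuple j)
        continuous_zero).1 hz) x
  exact key N n (by omega) x

end Squares

end PoissonSpectral

end

/-! ### The theorem -/

theorem mainTheorem2
    (d : ℕ) (X : Type*) [TopologicalSpace X] [T2Space X] [SecondCountableTopology X]
    [ConnectedSpace X] [NoncompactSpace X]
    [ChartedSpace (EuclideanSpace ℝ (Fin d)) X] [IsManifold (𝓡 d) ∞ X]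
    [MeasurableSpace X] [BorelSpace X]
    (σ : MeasureTheory.Measure X) [MeasureTheory.IsLocallyFiniteMeasure σ]
    [σ.IsOpenPosMeasure] [MeasureTheory.NullSingletonClass σ] (hσ : σ Set.univ = ⊤) :
    -- the functional `s` is well defined: the integrals exist
    (∀ f : PoissonSpectral.FinSeq d X,
      MeasureTheory.Integrable f.toFun (PoissonSpectral.lebesguePoisson σ) ∧
      MeasureTheory.Integrable
        (PoissonSpectral.kkConv f.toFun (PoissonSpectral.conjFun f.toFun))
        (PoissonSpectral.lebesguePoisson σ)) ∧
    -- `s` is non-negative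
    (∀ f : PoissonSpectral.FinSeq d X,
      0 ≤ (PoissonSpectral.poissonFunctional σ
        (PoissonSpectral.kkConv f.toFun (PoissonSpectral.conjFun f.toFun))).re ∧
      (PoissonSpectral.poissonFunctional σ
        (PoissonSpectral.kkConv f.toFun (PoissonSpectral.conjFun f.toFun))).im = 0) ∧
    -- `s` is non-degenerate
    (∀ f : PoissonSpectral.FinSeq d X,
      PoissonSpectral.poissonFunctional σ
        (PoissonSpectral.kkConv f.toFun (PoissonSpectral.conjFun f.toFun)) = 0 → f = 0) ∧
    -- growth of the Lebesgue–Poisson measure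
    (∀ Λ : Set X, IsCompact Λ → ∃ C : ℝ, 0 < C ∧ ∀ n : ℕ,
      PoissonSpectral.lebesguePoisson σ (PoissonSpectral.FinConfig.ofCardIn n Λ) ≤
        ENNReal.ofReal C ^ n) := by
  open PoissonSpectral in
  refine ⟨fun f => ⟨f.isTestFunction.integrable σ f.toFun_eq,
    f.isTestFunction.integrable_kkConv σ f.toFun_eq⟩, fun f => ?_, fun f h0 => ?_, fun Λ hΛ => ?_⟩
  · obtain ⟨N, hN⟩ := f.isTestFunction.exists_card_bound
    rw [f.isTestFunction.poissonFunctional_kkConv σ hN f.toFun_eq]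
    refine ⟨?_, Complex.ofReal_im _⟩
    rw [Complex.ofReal_re]
    exact Finset.sum_nonneg fun j _ => by positivity
  · refine DFinsupp.ext fun n => Subtype.ext (funext fun x => ?_)
    have := f.isTestFunction.tuple_eq_zero σ f.toFun_eq h0 n x
    rwa [f.onMultiset_map_univ] at this
  -- Adding 1 keeps the constant positive even if σ(Λ) = 0; σ(Λ) is finite as Λ is compact.
  · refine ⟨(σ Λ).toReal + 1, by positivity, fun n => ?_⟩
    have h : σ Λ ≤ ENNReal.ofReal ((σ Λ).toReal + 1) := by
      conv_lhs => rw [← ENNReal.ofReal_toReal hΛ.measure_lt_top.ne]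
      exact ENNReal.ofReal_le_ofReal (by simp)
    exact (lebesguePoisson_ofCardIn_le σ n hΛ.isClosed).trans (by gcongr)
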